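/- Fix integers $n\ge 2$ and $k\ge 1$ and a finite set $\mathcal A$ of $n+k-1$ arms. At each step $t=1,2,\dots$ the learner selects, possibly at random and using the past selections and observations, a $k$-element set $s(t)\subseteq\mathcal A$ and observes the binary rewards $X_{a,s(t)}\in\{0,1\}$ of all arms $a\in s(t)$. Their joint law is determined by the environment and depends on the selected set. Given $s(t)$, the rewards are drawn independently of the past. Write $P(a\mid s)=\mathbb E[X_{a,s}]$, $\mathbb E[Q(s)]=\sum_{a\in s}P(a\mid s)$, and let $s^*$ be a set that maximizes $\mathbb E[Q(s)]$. The environment satisfies *weak optimal set consistency* if $P(a\mid s)\ge P(a\mid s^*)$ for every sub-optimal set $s$ and every $a\in s\cap s^*$. Its *minimum gap* is $\min_{s\ne s^*}\mathbb E[Q(s^*)-Q(s)]$. The regret of an algorithm with horizon $T$ (which it may know) is $R(T)=\sum_{t=1}^T\mathbb E[Q(s^*)-Q(s(t))]$. For $\varepsilon>0$ let $\mathcal M_1(\varepsilon)$ be the class of environments that satisfy weak optimal set consistency with minimum gap $\varepsilon$ and in which, for every selected set, at most one arm of the set receives reward (mutually exclusive feedback). Let $\mathcal M_2(\varepsilon)$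 be the class of those that satisfy weak optimal set consistency with minimum gap $\varepsilon$ and in which, for every selected set, the rewards of its arms are independent (so that several arms can receive reward). **Theorem (regret lower bound).** There is an absolute constant $c>0$ such that for all $n\ge2$, $k\ge1$ and every set of $n+k-1$ arms the following holds. 1. (Mutually exclusive feedback.) For every $0<\varepsilon\le \frac1{4k}$ there is an environment $E\in\mathcal M_1(\varepsilon)$ such that every algorithm whose regret on every environment of $\mathcal M_1(\varepsilon)$ is $o(T^a)$ for all $a>0$ has, on $E$, $$R(T)\ \ge\ c\,\frac{n\log T}{k\,\varepsilon}\qquad\text{for all sufficiently large }T .$$ 2. (Several arms can receive reward.) For every $0<\varepsilon\le\frac14$ there is an environment $E\in\mathcal M_2(\varepsilon)$ such that every algorithm whose regret on every environment of $\mathcal M_2(\varepsilon)$ is $o(T^a)$ for all $a>0$ has, on $E$, $$R(T)\ \ge\ c\,\frac{n\log T}{\varepsilon}\qquad\text{for all sufficiently large }T .$$ (In terms of the number $N=n+k-1$ of arms, $n=N-k+1$, which is at least $N/2$ as soon as $N\ge 2k$.) -/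

import Mathlib

/-- The sets the learner may select: the `k`-element sets of arms. -/
abbrev Choice (A : Type*) (k : ℕ) := {s : Finset A // s.card = k}

/-- A stochastic environment with binary rewards. When the set `s` is selected, a random set
`R ⊆ s` of arms receives reward: `X_{a,s} = 1` if `a ∈ R` and `X_{a,s} = 0` otherwise.
`law s` is the joint law of the rewards, written as the law of `R`. It is otherwise an arbitrary
function of `s`. -/
structure Environment (A : Type*) (k : ℕ) where
  law : Choice A k → PMF (Finset A)
  support_subset : ∀ s, ∀ R ∈ (law s).support, R ⊆ s.1

namespace Environment

variable {A : Type*} [Fintype A] [DecidableEq A] {k : ℕ}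

/-- `P(a | s) = 𝔼 X_{a,s}`, the probability that `a` receives reward when `s` is selected. -/
noncomputable def meanReward (E : Environment A k) (s : Choice A k) (a : A) : ℝ :=
  ∑ R : Finset A, if a ∈ R then (E.law s R).toReal else 0

/-- `𝔼 Q(s)`, the expected total reward of the set `s`. -/
noncomputable def value (E : Environment A k) (s : Choice A k) : ℝ :=
  ∑ a ∈ s.1, E.meanReward s a

/-- `s` maximizes the expected total reward. -/
def IsOptimal (E : Environment A k) (s : Choice A k) : Prop :=
  ∀ s', E.value s' ≤ E.value s

/-- Weak optimal set consistency: `P(a | s) ≥ P(a | s*)` for every sub-optimal set `s` and every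
arm `a` common to `s` and the optimal set `s*`. -/
def WeakOptimalSetConsistent (E : Environment A k) : Prop :=
  ∀ sOpt, E.IsOptimal sOpt → ∀ s, ¬ E.IsOptimal s → ∀ a ∈ s.1 ∩ sOpt.1,
    E.meanReward sOpt a ≤ E.meanReward s a

/-- The minimum of `𝔼 Q(s*) - 𝔼 Q(s)` over all sets `s ≠ s*` is `ε`, where `s*` is optimal. For
`0 < ε` this makes the optimal set unique. -/
def HasMinGap (E : Environment A k) (ε : ℝ) : Prop :=
  ∃ sOpt, E.IsOptimal sOpt ∧ IsLeast ((fun s => E.value sOpt - E.value s) '' {s | s ≠ sOpt}) ε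

/-- First feedback model: at most one arm of the selected set receives reward. -/
def MutuallyExclusive (E : Environment A k) : Prop :=
  ∀ s, ∀ R ∈ (E.law s).support, R.card ≤ 1

/-- Second feedback model: given the selected set `s`, the rewards of its arms are independent,
so their joint law is the product of its marginals. -/
def IndependentRewards (E : Environment A k) : Prop :=
  ∀ s, ∀ R ⊆ s.1, (E.law s R).toReal =
    ∏ a ∈ s.1, if a ∈ R then E.meanReward s a else 1 - E.meanReward s a

end Environment

/-- A possibly randomized policy: the conditional law of the next selected set, given the number
`t` of past steps and, for each of them, the selected set and the observed rewards. -/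
abbrev Policy (A : Type*) (k : ℕ) :=
  (t : ℕ) → (Fin t → Choice A k × Finset A) → PMF (Choice A k)

/-- An algorithm receives the horizon `T` as an input, and may use a different policy for each. -/
abbrev BanditAlgorithm (A : Type*) (k : ℕ) := ℕ → Policy A k

section Regret

variable {A : Type*} [Fintype A] [DecidableEq A] {k : ℕ}

/-- The probability of the `T`-step history `h` when the policy `π` interacts with `E`. -/
noncomputable def historyProb (E : Environment A k) (π : Policy A k) (T : ℕ)
    (h : Fin T → Choice A k × Finset A) : ℝ :=
  ∏ t : Fin T, (π t (fun i => h (Fin.castLE t.isLt.le i)) (h t).1).toReal *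
    (E.law (h t).1 (h t).2).toReal

/-- The regret `R(T) = ∑_{t ≤ T} 𝔼 [Q(s*) - Q(s(t))]`, as an expectation over `T`-step
histories. -/
noncomputable def regret (E : Environment A k) (π : Policy A k) (T : ℕ) : ℝ :=
  ∑ h : Fin T → Choice A k × Finset A, historyProb E π T h *
    ∑ t : Fin T, ((⨆ s, E.value s) - E.value (h t).1)

/-- On every environment of the class `𝓔`, the algorithm has regret `o(T ^ a)` for all `a > 0`. -/
def SubpolynomialRegret (𝓔 : Set (Environment A k)) (φ : BanditAlgorithm A k) : Prop :=
  ∀ E ∈ 𝓔, ∀ a : ℝ, 0 < a →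
    (fun T : ℕ => regret E (φ T) T) =o[Filter.atTop] fun T : ℕ => (T : ℝ) ^ a

/-- The environments of the first feedback model that satisfy weak optimal set consistency with
minimum gap `ε`. -/
def exclusiveClass (A : Type*) [Fintype A] [DecidableEq A] (k : ℕ) (ε : ℝ) :
    Set (Environment A k) :=
  {E | E.MutuallyExclusive ∧ E.WeakOptimalSetConsistent ∧ E.HasMinGap ε}

/-- The environments of the second feedback model that satisfy weak optimal set consistency with
minimum gap `ε`. -/
def independentClass (A : Type*) [Fintype A] [DecidableEq A] (k : ℕ) (ε : ℝ) :
    Set (Environment A k) :=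
  {E | E.IndependentRewards ∧ E.WeakOptimalSetConsistent ∧ E.HasMinGap ε}

end Regret

/-! Both parts are change-of-measure lower bounds in the manner of Lai and Robbins. Fix a core `K`
of `k - 1` arms, each of mean `q`, and an arm `b` of mean `p`. In the base environment the optimal
set is `insert b K`. For each of the `n - 1` arms `x` outside `insert b K` there is an alternative
with optimal set `insert x K`, differing from the base only in the mean of `x` in that one set: `p -
ε` in the base, `p + ε` in the alternative.

The difficulty is to keep consistency without letting other sets reveal which environment is
present. Consistency in the alternative demands that `x` have mean at least `p + ε` in every
sub-optimal set containing it. So `x` has mean exactly `p + ε` in all those sets, in the base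
environment too, where `x` is not in the optimal set and consistency asks nothing of it. Such sets
remain sub-optimal because each lacks a core arm and `q ≥ p + 3ε` (`sum_hardMean_le`). Hence only
plays of `insert x K` are informative (`hardMean_eq_of_ne`).

If `D` bounds the divergence between the two laws on `insert x K`, the Bretagnolle–Huber inequality
forces at least `log T / (4D)` expected plays of that set when regret is subpolynomial in both
environments (`log_le_mul_expectedPlays`). Each play costs at least `ε`, and the `n - 1` sets are
distinct, so their costs add (`log_le_regret`).

The models differ only in `D`. With independent rewards `p` is a constant and `D = 24ε²`. With
exclusive rewards the means in a set sum to at most `1`, so `p` and `q` are taken of order `1/k`;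
the divergence is then of order `ε²/p`, giving `D = 24kε²` and the loss of the factor `k`. -/

open Finset

set_option linter.unusedSectionVars false

/-! ### Laws of histories, divergence decomposition and the Bretagnolle–Huber inequality. -/

section History

variable {A : Type*} [Fintype A] [DecidableEq A] {k : ℕ}

theorem PMF.sum_toReal_eq_one {α : Type*} [Fintype α] (p : PMF α) : ∑ a, (p a).toReal = 1 := by
  rw [← ENNReal.toReal_sum fun a _ => p.apply_ne_top a, ← tsum_fintype (L := .unconditional _),
    p.tsum_coe, ENNReal.toReal_one]

theorem historyProb_nonneg (E : Environment A k) (π : Policy A k) (T : ℕ)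
    (h : Fin T → Choice A k × Finset A) : 0 ≤ historyProb E π T h :=
  Finset.prod_nonneg fun _ _ => mul_nonneg ENNReal.toReal_nonneg ENNReal.toReal_nonneg

theorem historyProb_snoc (E : Environment A k) (π : Policy A k) (T : ℕ)
    (h : Fin T → Choice A k × Finset A) (x : Choice A k × Finset A) :
    historyProb E π (T + 1) (Fin.snoc (α := fun _ => Choice A k × Finset A) h x) =
      historyProb E π T h * ((π T h x.1).toReal * (E.law x.1 x.2).toReal) := by
  have hpast : ∀ (m : ℕ) (hm : m ≤ T) (hm' : m ≤ T + 1),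
      (fun i : Fin m => Fin.snoc (α := fun _ => Choice A k × Finset A) h x (Fin.castLE hm' i)) =
        fun i => h (Fin.castLE hm i) := by
    intro m hm hm'
    funext i
    exact Fin.snoc_castSucc (α := fun _ => Choice A k × Finset A) x h (Fin.castLE hm i)
  unfold historyProb
  rw [Fin.prod_univ_castSucc]
  congr 1
  · refine Finset.prod_congr rfl fun t _ => ?_
    rw [Fin.snoc_castSucc, hpast t.castSucc t.isLt.le]
    rfl
  · rw [Fin.snoc_last, hpast (Fin.last T) le_rfl]
    rfl

/-- The expectation of a function of the `T`-step history. -/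
noncomputable def historyExp (E : Environment A k) (π : Policy A k) (T : ℕ)
    (f : (Fin T → Choice A k × Finset A) → ℝ) : ℝ :=
  ∑ h, historyProb E π T h * f h

theorem historyExp_succ (E : Environment A k) (π : Policy A k) (T : ℕ)
    (f : (Fin (T + 1) → Choice A k × Finset A) → ℝ) :
    historyExp E π (T + 1) f = historyExp E π T fun h => ∑ s, (π T h s).toReal *
      ∑ R, (E.law s R).toReal *
        f (Fin.snoc (α := fun _ => Choice A k × Finset A) h (s, R)) := by
  unfold historyExp
  rw [← (Fin.snocEquiv fun _ : Fin (T + 1) => Choice A k × Finset A).sum_comp,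
    Fintype.sum_prod_type_right]
  refine Finset.sum_congr rfl fun h _ => ?_
  rw [Fintype.sum_prod_type, Finset.mul_sum]
  refine Finset.sum_congr rfl fun s _ => ?_
  rw [Finset.mul_sum, Finset.mul_sum]
  refine Finset.sum_congr rfl fun R _ => ?_
  have := historyProb_snoc E π T h (s, R)
  change historyProb E π (T + 1) (Fin.snoc (α := fun _ => Choice A k × Finset A) h (s, R)) *
    f (Fin.snoc (α := fun _ => Choice A k × Finset A) h (s, R)) = _
  rw [this]
  ring

theorem historyExp_add (E : Environment A k) (π : Policy A k) (T : ℕ)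
    (f g : (Fin T → Choice A k × Finset A) → ℝ) :
    historyExp E π T (fun h => f h + g h) = historyExp E π T f + historyExp E π T g := by
  simp only [historyExp, mul_add, Finset.sum_add_distrib]

theorem historyExp_mono (E : Environment A k) (π : Policy A k) (T : ℕ)
    {f g : (Fin T → Choice A k × Finset A) → ℝ} (hfg : ∀ h, f h ≤ g h) :
    historyExp E π T f ≤ historyExp E π T g :=
  Finset.sum_le_sum fun h _ => mul_le_mul_of_nonneg_left (hfg h) (historyProb_nonneg E π T h)

theorem sum_historyProb (E : Environment A k) (π : Policy A k) (T : ℕ) :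
    ∑ h, historyProb E π T h = 1 := by
  have key : historyExp E π T (fun _ => 1) = 1 := by
    induction T with
    | zero => simp [historyExp, historyProb]
    | succ T ih =>
      rw [historyExp_succ]
      simpa only [mul_one, PMF.sum_toReal_eq_one] using ih
  simpa [historyExp] using key

/-- Given the selected set, a function of the rewards may be replaced by its mean. -/
theorem historyExp_sum_reward (E : Environment A k) (π : Policy A k) (T : ℕ)
    (F : Choice A k → Finset A → ℝ) :
    historyExp E π T (fun h => ∑ t, F (h t).1 (h t).2) =
      historyExp E π T fun h => ∑ t, ∑ R, (E.law (h t).1 R).toReal * F (h t).1 R := by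
  induction T with
  | zero => simp
  | succ T ih =>
    rw [historyExp_succ, historyExp_succ]
    simp only [Fin.sum_univ_castSucc, Fin.snoc_castSucc, Fin.snoc_last, mul_add,
      Finset.sum_add_distrib, ← Finset.sum_mul, PMF.sum_toReal_eq_one, one_mul]
    rw [historyExp_add, historyExp_add, ih]

/-- The log-likelihood ratio of the rewards in a history under two environments. -/
noncomputable def logLikelihoodRatio (E E' : Environment A k) {T : ℕ}
    (h : Fin T → Choice A k × Finset A) : ℝ :=
  ∑ t, Real.log ((E.law (h t).1 (h t).2).toReal / (E'.law (h t).1 (h t).2).toReal)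

/-- The same policy acts in both environments, so its factors cancel in the likelihood ratio and
only the reward laws remain. -/
theorem historyProb_eq_mul_exp {E E' : Environment A k}
    (hac : ∀ s R, (E'.law s R).toReal = 0 → (E.law s R).toReal = 0) (π : Policy A k) {T : ℕ}
    {h : Fin T → Choice A k × Finset A} (hP : historyProb E π T h ≠ 0) :
    historyProb E' π T h = historyProb E π T h * Real.exp (-logLikelihoodRatio E E' h) := by
  unfold logLikelihoodRatio historyProb at *
  rw [← Finset.sum_neg_distrib, Real.exp_sum, ← Finset.prod_mul_distrib]
  refine Finset.prod_congr rfl fun t _ => ?_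
  have h1 := (Finset.prod_ne_zero_iff.mp hP) t (Finset.mem_univ t)
  have h2 : (E.law (h t).1 (h t).2).toReal ≠ 0 := right_ne_zero_of_mul h1
  have h3 : (E'.law (h t).1 (h t).2).toReal ≠ 0 := fun h0 => h2 (hac _ _ h0)
  have h2' := lt_of_le_of_ne ENNReal.toReal_nonneg h2.symm
  have h3' := lt_of_le_of_ne ENNReal.toReal_nonneg h3.symm
  rw [Real.exp_neg, Real.exp_log (div_pos h2' h3')]
  field_simp

/-- The Bretagnolle–Huber inequality for the laws of histories. -/
theorem exp_neg_half_llr_le {E E' : Environment A k}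
    (hac : ∀ s R, (E'.law s R).toReal = 0 → (E.law s R).toReal = 0) (π : Policy A k) (T : ℕ)
    (S : Finset (Fin T → Choice A k × Finset A)) :
    Real.exp (-(historyExp E π T (logLikelihoodRatio E E') / 2)) ≤
      √(∑ h ∈ S, historyProb E π T h) + √(∑ h ∈ Sᶜ, historyProb E' π T h) := by
  set m := historyExp E π T (logLikelihoodRatio E E') with hm
  have hP := historyProb_nonneg E π T
  have hQ := historyProb_nonneg E' π T
  -- Jensen's inequality for `exp` by its tangent line at `-m / 2`. The linear term has mean zero,
  -- and the bound becomes the Hellinger affinity of the two laws, which Cauchy–Schwarz then splits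
  -- over `S` and its complement.
  have h1 : Real.exp (-(m / 2)) = ∑ h, historyProb E π T h *
      (Real.exp (-(m / 2)) * (1 + (m - logLikelihoodRatio E E' h) / 2)) := by
    have : ∀ h, historyProb E π T h *
      (Real.exp (-(m / 2)) * (1 + (m - logLikelihoodRatio E E' h) / 2)) =
      Real.exp (-(m / 2)) * (1 + m / 2) * historyProb E π T h - Real.exp (-(m / 2)) / 2 *
        (historyProb E π T h * logLikelihoodRatio E E' h) := fun h => by ring
    simp only [this]
    rw [Finset.sum_sub_distrib, ← Finset.mul_sum, ← Finset.mul_sum, sum_historyProb]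
    change _ = _ - _ * m
    ring
  have h2 : ∀ h, historyProb E π T h *
      (Real.exp (-(m / 2)) * (1 + (m - logLikelihoodRatio E E' h) / 2)) ≤
      √(historyProb E π T h) * √(historyProb E' π T h) := by
    intro h
    by_cases h0 : historyProb E π T h = 0
    · simp [h0]
    have e1 : √(historyProb E π T h) * √(historyProb E' π T h) =
        historyProb E π T h * Real.exp (-(logLikelihoodRatio E E' h / 2)) := by
      rw [historyProb_eq_mul_exp hac π h0, Real.sqrt_mul (hP h), ← mul_assoc,
        Real.mul_self_sqrt (hP h), ← Real.exp_half]
      ring_nf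
    have e2 := Real.add_one_le_exp ((m - logLikelihoodRatio E E' h) / 2)
    have e3 : Real.exp (-(logLikelihoodRatio E E' h / 2)) =
        Real.exp (-(m / 2)) * Real.exp ((m - logLikelihoodRatio E E' h) / 2) := by
      rw [← Real.exp_add]; ring_nf
    rw [e1, e3, add_comm]
    gcongr
    exact hP h
  have hle : ∀ (E : Environment A k) (U : Finset (Fin T → Choice A k × Finset A)),
      √(∑ h ∈ U, historyProb E π T h) ≤ 1 := fun E U => by
    refine Real.sqrt_le_iff.mpr ⟨zero_le_one, ?_⟩
    rw [one_pow, ← sum_historyProb E π T]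
    exact Finset.sum_le_sum_of_subset_of_nonneg (Finset.subset_univ U)
      fun h _ _ => historyProb_nonneg E π T h
  calc Real.exp (-(m / 2)) ≤ ∑ h, √(historyProb E π T h) * √(historyProb E' π T h) :=
        h1.le.trans (Finset.sum_le_sum fun h _ => h2 h)
    _ = ∑ h ∈ S, √(historyProb E π T h) * √(historyProb E' π T h) +
        ∑ h ∈ Sᶜ, √(historyProb E π T h) * √(historyProb E' π T h) :=
        (Finset.sum_add_sum_compl _ _).symm
    _ ≤ √(∑ h ∈ S, historyProb E π T h) * √(∑ h ∈ S, historyProb E' π T h) +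
        √(∑ h ∈ Sᶜ, historyProb E π T h) * √(∑ h ∈ Sᶜ, historyProb E' π T h) :=
        add_le_add (Real.sum_sqrt_mul_sqrt_le _ hP hQ) (Real.sum_sqrt_mul_sqrt_le _ hP hQ)
    _ ≤ _ := add_le_add (mul_le_of_le_one_right (Real.sqrt_nonneg _) (hle _ _))
        (mul_le_of_le_one_left (Real.sqrt_nonneg _) (hle _ _))

end History

/-! ### From subpolynomial regret to logarithmically many plays. -/

section LowerBound

variable {A : Type*} [Fintype A] [DecidableEq A] {k : ℕ}

/-- The expected number of times that `s` is selected in `T` steps. -/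
noncomputable def expectedPlays (E : Environment A k) (π : Policy A k) (T : ℕ)
    (s : Choice A k) : ℝ :=
  historyExp E π T fun h => ∑ t, if (h t).1 = s then 1 else 0

/-- If two environments differ only on `s₁`, the divergence between the laws of histories is at
most the divergence on `s₁` times the expected number of selections of `s₁`. -/
theorem historyExp_llr_le {E E' : Environment A k} {s₁ : Choice A k} {D : ℝ}
    (hlaw : ∀ s, s ≠ s₁ → E.law s = E'.law s)
    (hkl : ∑ R, (E.law s₁ R).toReal * Real.log ((E.law s₁ R).toReal / (E'.law s₁ R).toReal) ≤ D)
    (π : Policy A k) (T : ℕ) :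
    historyExp E π T (logLikelihoodRatio E E') ≤ D * expectedPlays E π T s₁ := by
  have h1 := historyExp_sum_reward E π T
    fun s R => Real.log ((E.law s R).toReal / (E'.law s R).toReal)
  have h2 : D * expectedPlays E π T s₁ =
      historyExp E π T fun h => ∑ t, if (h t).1 = s₁ then D else 0 := by
    simp only [expectedPlays, historyExp]
    rw [Finset.mul_sum]
    refine Finset.sum_congr rfl fun h _ => ?_
    rw [mul_left_comm, Finset.mul_sum]
    simp only [mul_ite, mul_one, mul_zero]
  rw [h2]
  refine (le_of_eq h1).trans (historyExp_mono E π T fun h => Finset.sum_le_sum fun t _ => ?_)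
  split_ifs with hs
  · rw [hs]; exact hkl
  · refine (Finset.sum_eq_zero fun R _ => ?_).le
    rw [hlaw _ hs]
    by_cases h0 : (E'.law (h t).1 R).toReal = 0
    · simp [h0]
    · simp [div_self h0]

theorem regret_eq_historyExp {E : Environment A k} {s₀ : Choice A k} (hs₀ : E.IsOptimal s₀)
    (π : Policy A k) (T : ℕ) :
    regret E π T = historyExp E π T fun h => ∑ t, (E.value s₀ - E.value (h t).1) := by
  have : Nonempty (Choice A k) := ⟨s₀⟩
  have hsup : ⨆ s, E.value s = E.value s₀ :=
    le_antisymm (ciSup_le hs₀) (le_ciSup (Set.finite_range E.value).bddAbove s₀)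
  simp only [regret, historyExp, hsup]

/-- `s₀` beats every other set by at least `ε`. -/
def Environment.OptimalByGap (E : Environment A k) (s₀ : Choice A k) (ε : ℝ) : Prop :=
  ∀ s, s ≠ s₀ → E.value s + ε ≤ E.value s₀

theorem Environment.OptimalByGap.isOptimal {E : Environment A k} {s₀ : Choice A k} {ε : ℝ}
    (hgap : E.OptimalByGap s₀ ε) (hε : 0 ≤ ε) : E.IsOptimal s₀ := fun s => by
  by_cases hs : s = s₀
  · rw [hs]
  · linarith [hgap s hs]

theorem mul_sum_expectedPlays_le_regret {E : Environment A k} {s₀ : Choice A k} {ε : ℝ}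
    (hgap : E.OptimalByGap s₀ ε) (hε : 0 ≤ ε) {J : Finset (Choice A k)} (hJ : s₀ ∉ J)
    (π : Policy A k) (T : ℕ) :
    ε * ∑ s ∈ J, expectedPlays E π T s ≤ regret E π T := by
  have h1 : ε * ∑ s ∈ J, expectedPlays E π T s =
      historyExp E π T fun h => ∑ t, if (h t).1 ∈ J then ε else 0 := by
    simp only [expectedPlays, historyExp]
    rw [Finset.sum_comm, Finset.mul_sum]
    refine Finset.sum_congr rfl fun h _ => ?_
    rw [← Finset.mul_sum, mul_left_comm, Finset.sum_comm, Finset.mul_sum]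
    congr 1
    refine Finset.sum_congr rfl fun t _ => ?_
    rw [Finset.sum_ite_eq]
    simp
  rw [h1, regret_eq_historyExp (hgap.isOptimal hε)]
  refine historyExp_mono E π T fun h => Finset.sum_le_sum fun t _ => ?_
  split_ifs with hs
  · linarith [hgap (h t).1 fun h0 => hJ (h0 ▸ hs)]
  · exact sub_nonneg.mpr (hgap.isOptimal hε _)

/-- A Markov inequality: an event on which a sub-optimal set is selected in at least half of the
steps has a probability controlled by the regret. -/
theorem mul_prob_le_regret {E : Environment A k} {s₀ : Choice A k} {ε : ℝ}
    (hgap : E.OptimalByGap s₀ ε) (hε : 0 ≤ ε) (π : Policy A k) {T : ℕ}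
    {S : Finset (Fin T → Choice A k × Finset A)}
    (hS : ∀ h ∈ S, (T : ℝ) ≤ 2 * ∑ t, if (h t).1 = s₀ then (0 : ℝ) else 1) :
    ε * T / 2 * ∑ h ∈ S, historyProb E π T h ≤ regret E π T := by
  rw [regret_eq_historyExp (hgap.isOptimal hε), historyExp, Finset.mul_sum]
  have hpath : ∀ h : Fin T → Choice A k × Finset A,
      ε * (∑ t, if (h t).1 = s₀ then (0 : ℝ) else 1) ≤
        ∑ t, (E.value s₀ - E.value (h t).1) := fun h => by
    rw [Finset.mul_sum]
    refine Finset.sum_le_sum fun t _ => ?_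
    split_ifs with hs
    · simp [hs]
    · linarith [hgap _ hs]
  refine (Finset.sum_le_sum fun h hh => ?_).trans
    (Finset.sum_le_sum_of_subset_of_nonneg (Finset.subset_univ S) fun h _ _ =>
      mul_nonneg (historyProb_nonneg E π T h) (Finset.sum_nonneg fun t _ =>
        sub_nonneg.mpr (hgap.isOptimal hε _)))
  rw [mul_comm]
  refine mul_le_mul_of_nonneg_left ((?_ : _ ≤ _).trans (hpath h)) (historyProb_nonneg E π T h)
  have := mul_le_mul_of_nonneg_left (hS h hh) hε
  linarith

/-- Regret of order `√T` makes the bad event have probability at most `T ^ (-1/2)`; the square root,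
as needed in Bretagnolle–Huber, is at most `T ^ (-1/4)`. -/
theorem sqrt_prob_le {ε T p r : ℝ} (hε : 0 < ε) (hT : 0 < T) (hp : ε * T / 2 * p ≤ r)
    (hr : r ≤ ε / 2 * T ^ (1 / 2 : ℝ)) : √p ≤ Real.exp (-(Real.log T / 4)) := by
  refine Real.sqrt_le_iff.mpr ⟨(Real.exp_pos _).le, ?_⟩
  have h1 : T * p ≤ T ^ (1 / 2 : ℝ) := by
    refine le_of_mul_le_mul_left ?_ (half_pos hε)
    linarith
  have h2 : T ^ (1 / 2 : ℝ) = T * Real.exp (-(Real.log T / 4)) ^ 2 := by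
    rw [Real.rpow_def_of_pos hT, ← Real.exp_nat_mul]
    nth_rw 2 [← Real.exp_log hT]
    rw [← Real.exp_add]
    congr 1
    push_cast
    ring
  exact le_of_mul_le_mul_left (h1.trans h2.le) hT

/-- An algorithm with subpolynomial regret on `E` and `E'`, which differ only on the set `s₁` that
is optimal for `E'`, selects `s₁` at least logarithmically often on `E`. -/
theorem log_le_mul_expectedPlays {𝓔 : Set (Environment A k)} {φ : BanditAlgorithm A k}
    (hφ : SubpolynomialRegret 𝓔 φ) {E E' : Environment A k} (hE : E ∈ 𝓔) (hE' : E' ∈ 𝓔)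
    {ε D : ℝ} (hε : 0 < ε) {s₀ s₁ : Choice A k} (hne : s₁ ≠ s₀) (hgap : E.OptimalByGap s₀ ε)
    (hgap' : E'.OptimalByGap s₁ ε) (hlaw : ∀ s, s ≠ s₁ → E.law s = E'.law s)
    (hac : ∀ R, (E'.law s₁ R).toReal = 0 → (E.law s₁ R).toReal = 0)
    (hkl : ∑ R, (E.law s₁ R).toReal *
      Real.log ((E.law s₁ R).toReal / (E'.law s₁ R).toReal) ≤ D) :
    ∀ᶠ T : ℕ in Filter.atTop, Real.log T / 4 ≤ D * expectedPlays E (φ T) T s₁ := by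
  have hac' : ∀ s R, (E'.law s R).toReal = 0 → (E.law s R).toReal = 0 := by
    intro s R h0
    by_cases hs : s = s₁
    · subst hs; exact hac R h0
    · rw [hlaw s hs]; exact h0
  filter_upwards [(hφ E hE (1 / 2) (by norm_num)).bound (half_pos hε),
    (hφ E' hE' (1 / 2) (by norm_num)).bound (half_pos hε), Filter.eventually_ge_atTop 256]
    with T hR hR' hT
  have hT0 : (0 : ℝ) < T := by exact_mod_cast (by omega : 0 < T)
  have hnorm : ‖(T : ℝ) ^ (1 / 2 : ℝ)‖ = (T : ℝ) ^ (1 / 2 : ℝ) :=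
    Real.norm_of_nonneg (Real.rpow_nonneg hT0.le _)
  rw [hnorm] at hR hR'
  -- The test event: `s₀` is missed in at least half of the steps. It is costly under `E`. Off it
  -- `s₀` is played more than half of the time, so `s₁` is missed at least that often, which is
  -- costly under `E'`.
  let S : Finset (Fin T → Choice A k × Finset A) :=
    {h | (T : ℝ) ≤ 2 * ∑ t, if (h t).1 = s₀ then (0 : ℝ) else 1}
  have hS := sqrt_prob_le hε hT0 (mul_prob_le_regret (S := S) hgap hε.le (φ T) fun h hh =>
    (Finset.mem_filter.mp hh).2) ((le_abs_self _).trans hR)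
  have hSc := sqrt_prob_le hε hT0 (mul_prob_le_regret (S := Sᶜ) hgap' hε.le (φ T) fun h hh => by
    have h1 : ¬ (T : ℝ) ≤ 2 * ∑ t, if (h t).1 = s₀ then (0 : ℝ) else 1 := fun h0 =>
      (Finset.mem_compl.mp hh) (Finset.mem_filter.mpr ⟨Finset.mem_univ _, h0⟩)
    have h2 : (T : ℝ) ≤ (∑ t, if (h t).1 = s₀ then (0 : ℝ) else 1) +
        ∑ t, if (h t).1 = s₁ then (0 : ℝ) else 1 := by
      rw [← Finset.sum_add_distrib]
      calc (T : ℝ) = ∑ _t : Fin T, (1 : ℝ) := by simp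
        _ ≤ _ := Finset.sum_le_sum fun t _ => by
          split_ifs with h3 h4
          · exact absurd (h4.symm.trans h3) hne
          all_goals norm_num
    linarith) ((le_abs_self _).trans hR')
  have hBH := (exp_neg_half_llr_le hac' (φ T) T S).trans (add_le_add hS hSc)
  have hm := historyExp_llr_le hlaw hkl (φ T) T
  -- Bretagnolle–Huber bounds the divergence below by `log T / 2 - 2 log 2`; the threshold `256 = 2
  -- ^ 8` is where this reaches `log T / 4`.
  have h256 : 8 * Real.log 2 ≤ Real.log T := by
    have : Real.log ((2 : ℝ) ^ 8) = 8 * Real.log 2 := by rw [Real.log_pow]; norm_num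
    rw [← this]
    exact Real.log_le_log (by norm_num) (by norm_num; exact_mod_cast hT)
  have hexp : Real.exp (-(Real.log T / 4)) + Real.exp (-(Real.log T / 4)) =
      Real.exp (Real.log 2 + -(Real.log T / 4)) := by
    rw [Real.exp_add, Real.exp_log two_pos]; ring
  rw [hexp, Real.exp_le_exp] at hBH
  linarith

/-- The regret forced by a family of alternatives to `E`, each of which differs from `E` only on
its own optimal set. -/
theorem log_le_regret {𝓔 : Set (Environment A k)} {φ : BanditAlgorithm A k}
    (hφ : SubpolynomialRegret 𝓔 φ) {E : Environment A k} (hE : E ∈ 𝓔) {ε D : ℝ} (hε : 0 < ε)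
    (hD : 0 < D) {s₀ : Choice A k} (hgap : E.OptimalByGap s₀ ε) {J : Finset (Choice A k)}
    (hJ : s₀ ∉ J)
    (halt : ∀ s₁ ∈ J, ∃ E' ∈ 𝓔, E'.OptimalByGap s₁ ε ∧ (∀ s, s ≠ s₁ → E.law s = E'.law s) ∧
      (∀ R, (E'.law s₁ R).toReal = 0 → (E.law s₁ R).toReal = 0) ∧
      ∑ R, (E.law s₁ R).toReal *
        Real.log ((E.law s₁ R).toReal / (E'.law s₁ R).toReal) ≤ D) :
    ∀ᶠ T : ℕ in Filter.atTop, ε * (J.card * (Real.log T / (4 * D))) ≤ regret E (φ T) T := by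
  have hall : ∀ᶠ T : ℕ in Filter.atTop, ∀ s₁ ∈ J,
      Real.log T / 4 ≤ D * expectedPlays E (φ T) T s₁ := by
    rw [Filter.eventually_all_finset]
    intro s₁ hs₁
    obtain ⟨E', hE', hgap', hlaw, hac, hkl⟩ := halt s₁ hs₁
    exact log_le_mul_expectedPlays hφ hE hE' hε (fun h : s₁ = s₀ => hJ (h ▸ hs₁)) hgap hgap' hlaw hac hkl
  filter_upwards [hall] with T hT
  refine le_trans (mul_le_mul_of_nonneg_left ?_ hε.le)
    (mul_sum_expectedPlays_le_regret hgap hε.le hJ (φ T) T)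
  rw [← nsmul_eq_mul]
  refine Finset.card_nsmul_le_sum _ _ _ fun s hs => ?_
  rw [div_le_iff₀ (by positivity)]
  linarith [hT s hs]

end LowerBound

/-! ### The hard instances: optimality, consistency and the common regret bound. -/

section HardFamily

variable {A : Type*} [Fintype A] [DecidableEq A] {k : ℕ}

/-- A bound on the Kullback–Leibler divergence in terms of the density `F` of `p` with respect
to `q`. -/
theorem sum_mul_log_div_le {α : Type*} [Fintype α] {p q F : α → ℝ} (hp : ∀ x, 0 ≤ p x)
    (hq : ∀ x, 0 ≤ q x) (hsum : ∑ x, p x = 1) (hF : ∀ x, p x = F x * q x) :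
    ∑ x, p x * Real.log (p x / q x) ≤ ∑ x, p x * F x - 1 := by
  rw [← hsum, ← Finset.sum_sub_distrib]
  refine Finset.sum_le_sum fun x _ => ?_
  rcases (hp x).eq_or_lt with h0 | h0
  · simp [← h0]
  have hq0 : q x ≠ 0 := fun h => by rw [hF x, h, mul_zero] at h0; exact h0.false
  have hdiv : p x / q x = F x := by rw [hF x]; exact mul_div_cancel_right₀ _ hq0
  have h1 : 0 < F x := hdiv ▸ div_pos h0 ((hq x).lt_of_ne hq0.symm)
  rw [hdiv]
  -- With `log F ≤ F - 1` the divergence is bounded by the chi-square divergence, which is rational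
  -- in the means.
  have := mul_le_mul_of_nonneg_left (Real.log_le_sub_one_of_pos h1) (hp x)
  linarith

/-- The mean rewards of the hard instances. There is a core `K` of `k - 1` arms with mean `q` and an
arm `b` with mean `p`. Any other arm has mean `p + ε`, except that an arm `c ≠ x` has mean `p - ε`
in the set `insert c K`. The optimal set is `insert x K`. -/
noncomputable def hardMean (K : Finset A) (b : A) (p q ε : ℝ) (x : A) (s : Finset A) (c : A) : ℝ :=
  if c ∈ K then q else if c = b then p else if s = insert c K ∧ c ≠ x then p - ε else p + ε

/-- The set formed by the core `K` and one more arm. -/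
def coreSet {K : Finset A} (hK : K.card + 1 = k) (x : A) (hx : x ∉ K) : Choice A k :=
  ⟨insert x K, by rw [Finset.card_insert_of_notMem hx, hK]⟩

variable {K : Finset A} {b x : A} {p q ε : ℝ}

theorem coreSet_inj (hK : K.card + 1 = k) {x y : A} {hx : x ∉ K} {hy : y ∉ K}
    (h : coreSet hK x hx = coreSet hK y hy) : x = y := by
  have h1 : insert x K = insert y K := congrArg Subtype.val h
  have h2 : x ∈ insert y K := h1 ▸ Finset.mem_insert_self x K
  exact (Finset.mem_insert.mp h2).resolve_right hx

theorem hardMean_le (hε : 0 ≤ ε) (hpq : p + 3 * ε ≤ q) (s : Finset A) (c : A) :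
    hardMean K b p q ε x s c ≤ q := by
  unfold hardMean
  split_ifs <;> linarith

theorem hardMean_le_of_notMem (hε : 0 ≤ ε) (s : Finset A) {c : A} (hc : c ∉ K) :
    hardMean K b p q ε x s c ≤ p + ε := by
  unfold hardMean
  split_ifs <;> linarith

theorem hardMean_nonneg (hε : 0 ≤ ε) (hp : ε ≤ p) (hpq : p + 3 * ε ≤ q) (s : Finset A) (c : A) :
    0 ≤ hardMean K b p q ε x s c := by
  unfold hardMean
  split_ifs <;> linarith

theorem sum_hardMean_insert {c : A} (hc : c ∉ K) :
    ∑ a ∈ insert c K, hardMean K b p q ε x (insert c K) a =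
      K.card * q + if c = b then p else if c ≠ x then p - ε else p + ε := by
  rw [Finset.sum_insert hc, add_comm]
  congr 1
  · rw [← nsmul_eq_mul]
    refine Finset.sum_eq_card_nsmul fun a ha => ?_
    simp [hardMean, ha]
  · simp [hardMean, hc]

theorem exists_eq_insert_or_two_le (hK : K.card + 1 = k) (s : Choice A k) :
    (∃ c, c ∉ K ∧ s.1 = insert c K) ∨ 2 ≤ (s.1 \ K).card := by
  by_cases h : 2 ≤ (s.1 \ K).card
  · exact .inr h
  have h1 := Finset.card_sdiff_add_card_inter s.1 K
  have h2 : (s.1 ∩ K).card ≤ K.card := Finset.card_le_card Finset.inter_subset_right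
  have h3 := s.2
  have h4 : s.1 ∩ K = K := Finset.eq_of_subset_of_card_le Finset.inter_subset_right (by omega)
  obtain ⟨c, hc⟩ := Finset.card_eq_one.mp (show (s.1 \ K).card = 1 by omega)
  refine .inl ⟨c, ?_, ?_⟩
  · have : c ∈ s.1 \ K := hc ▸ Finset.mem_singleton_self c
    exact (Finset.mem_sdiff.mp this).2
  · have := Finset.sdiff_union_inter s.1 K
    rw [hc, h4] at this
    rw [← this, Finset.insert_eq]

/-- A set with `j ≥ 2` arms outside the core trades `j - 1` core arms for arms of mean at most `p +
ε`. The claim needs `(j - 1)(q - p) ≥ (j + 1)ε`; the worst case `j = 2` is the origin of the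
constant `3`. -/
theorem sum_hardMean_le (hK : K.card + 1 = k) (hε : 0 ≤ ε) (hpq : p + 3 * ε ≤ q)
    (s : Choice A k) (hs : 2 ≤ (s.1 \ K).card) :
    ∑ a ∈ s.1, hardMean K b p q ε x s.1 a ≤ K.card * q + (p - ε) := by
  have h1 : ∑ a ∈ s.1 ∩ K, hardMean K b p q ε x s.1 a ≤ (s.1 ∩ K).card * q := by
    rw [← nsmul_eq_mul]
    exact Finset.sum_le_card_nsmul _ _ _ fun a _ => hardMean_le hε hpq s.1 a
  have h2 : ∑ a ∈ s.1 \ K, hardMean K b p q ε x s.1 a ≤ (s.1 \ K).card * (p + ε) := by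
    rw [← nsmul_eq_mul]
    exact Finset.sum_le_card_nsmul _ _ _ fun a ha =>
      hardMean_le_of_notMem hε s.1 (Finset.mem_sdiff.mp ha).2
  rw [← Finset.sum_inter_add_sum_sdiff s.1 K]
  have h3 : ((s.1 \ K).card : ℝ) + (s.1 ∩ K).card = K.card + 1 := by
    have := Finset.card_sdiff_add_card_inter s.1 K
    rw [s.2.trans hK.symm] at this
    exact_mod_cast this
  have h4 : (2 : ℝ) ≤ (s.1 \ K).card := by exact_mod_cast hs
  have h5 : ((s.1 ∩ K).card : ℝ) = K.card + 1 - (s.1 \ K).card := by linarith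
  rw [h5] at h1
  nlinarith [mul_nonneg (show (0 : ℝ) ≤ (s.1 \ K).card - 1 by linarith) (sub_nonneg.mpr hpq),
    mul_nonneg (sub_nonneg.mpr h4) hε]

/-- The environment `E` has the mean rewards of the hard instance with optimal set
`insert x K`. -/
def Environment.HasHardMeans (E : Environment A k) (K : Finset A) (b : A) (p q ε : ℝ)
    (x : A) : Prop :=
  ∀ s : Choice A k, ∀ c ∈ s.1, E.meanReward s c = hardMean K b p q ε x s.1 c

namespace Environment.HasHardMeans

variable {E : Environment A k}

theorem value_eq (hE : E.HasHardMeans K b p q ε x) (s : Choice A k) :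
    E.value s = ∑ a ∈ s.1, hardMean K b p q ε x s.1 a :=
  Finset.sum_congr rfl fun a ha => hE s a ha

theorem value_coreSet (hE : E.HasHardMeans K b p q ε x) (hK : K.card + 1 = k) {c : A}
    (hc : c ∉ K) : E.value (coreSet hK c hc) =
      K.card * q + if c = b then p else if c ≠ x then p - ε else p + ε := by
  rw [hE.value_eq]
  exact sum_hardMean_insert hc

theorem optimalByGap (hE : E.HasHardMeans K b p q ε x) (hK : K.card + 1 = k) (hx : x ∉ K)
    (hε : 0 ≤ ε) (hpq : p + 3 * ε ≤ q) : E.OptimalByGap (coreSet hK x hx) ε := by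
  intro s hs
  rw [hE.value_coreSet hK hx]
  rcases exists_eq_insert_or_two_le hK s with ⟨c, hc, hsc⟩ | h2
  · obtain rfl : s = coreSet hK c hc := Subtype.ext hsc
    have hcx : c ≠ x := by rintro rfl; exact hs rfl
    rw [hE.value_coreSet hK hc, add_assoc]
    refine add_le_add_right ?_ _
    by_cases hcb : c = b
    · subst hcb
      simp [hcx.symm]
    · by_cases hxb : x = b
      · simp [hcb, hxb]
      · simp [hcb, hcx, hxb]
        linarith
  · rw [hE.value_eq]
    have := sum_hardMean_le (b := b) (x := x) hK hε hpq s h2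
    split_ifs with h3
    · linarith
    · exact absurd rfl ‹x ≠ x›
    · linarith

/-- The gap must be exactly `ε` for membership in the class. It is attained at `insert b K` when `x
≠ b`, and at `insert a K` when `x = b`; the latter needs a second arm outside the core, that is `n ≥
2`. -/
theorem hasMinGap (hE : E.HasHardMeans K b p q ε x) (hK : K.card + 1 = k) (hx : x ∉ K)
    (hb : b ∉ K) {a : A} (ha : a ∉ insert b K) (hε : 0 ≤ ε) (hpq : p + 3 * ε ≤ q) :
    E.HasMinGap ε := by
  have hgap := hE.optimalByGap hK hx hε hpq
  rw [Finset.mem_insert, not_or] at ha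
  refine ⟨coreSet hK x hx, hgap.isOptimal hε, ?_, ?_⟩
  · by_cases hxb : x = b
    · refine ⟨coreSet hK a ha.2, fun h => ha.1 ((coreSet_inj hK h).trans hxb), ?_⟩
      simp only [hE.value_coreSet]
      subst hxb
      simp [ha.1]
    · refine ⟨coreSet hK b hb, fun h => hxb (coreSet_inj hK h).symm, ?_⟩
      simp only [hE.value_coreSet]
      simp [hxb]
  · rintro _ ⟨s, hs, rfl⟩
    have := hgap s hs
    simp only
    linarith

/-- Core arms have mean `q` in every set, and the arm `x` completing the optimal set also has the
same mean everywhere, so the inequality holds with equality. -/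
theorem weakOptimalSetConsistent (hE : E.HasHardMeans K b p q ε x) (hK : K.card + 1 = k)
    (hx : x ∉ K) (hε : 0 < ε) (hpq : p + 3 * ε ≤ q) : E.WeakOptimalSetConsistent := by
  have hgap := hE.optimalByGap hK hx hε.le hpq
  intro sOpt hsOpt s hs c hc
  obtain rfl : sOpt = coreSet hK x hx := by
    by_contra hne
    linarith [hgap sOpt hne, hsOpt (coreSet hK x hx)]
  rw [Finset.mem_inter] at hc
  rw [hE _ c hc.2, hE _ c hc.1]
  by_cases hcK : c ∈ K
  · simp [hardMean, hcK]
  · obtain rfl : c = x := (Finset.mem_insert.mp hc.2).resolve_right hcK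
    simp [hardMean]

end Environment.HasHardMeans

/-- The base instance (`x = b`) and the alternative for `x` are indistinguishable away from `insert
x K`, since `x` already has its raised mean in all other sets. -/
theorem hardMean_eq_of_ne (s : Finset A) (hs : s ≠ insert x K) :
    hardMean K b p q ε b s = hardMean K b p q ε x s := by
  funext c
  unfold hardMean
  by_cases hcx : c = x
  · subst hcx
    simp [hs]
  · by_cases hcb : c = b <;> simp [hcx, hcb]

/-- The regret bound for a family of hard instances whose laws depend only on their means. -/
theorem log_le_regret_of_hasHardMeans {𝓔 : Set (Environment A k)} (hK : K.card + 1 = k)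
    (hb : b ∉ K) (hε : 0 < ε) (hpq : p + 3 * ε ≤ q) {D : ℝ} (hD : 0 < D)
    {E : A → Environment A k} (hE : ∀ x, (E x).HasHardMeans K b p q ε x)
    (hmem : ∀ x, x ∉ K → E x ∈ 𝓔)
    (hlaw : ∀ x (s : Choice A k), hardMean K b p q ε b s.1 = hardMean K b p q ε x s.1 →
      (E b).law s = (E x).law s)
    (hkl : ∀ x (s : Choice A k), x ∉ K → x ≠ b → s.1 = insert x K → ∃ F : Finset A → ℝ,
      (∀ R, ((E b).law s R).toReal = F R * ((E x).law s R).toReal) ∧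
      ∑ R, ((E b).law s R).toReal * F R ≤ 1 + D)
    {φ : BanditAlgorithm A k} (hφ : SubpolynomialRegret 𝓔 φ) :
    ∀ᶠ T : ℕ in Filter.atTop,
      ε * (((Fintype.card A - k : ℕ) : ℝ) * (Real.log T / (4 * D))) ≤ regret (E b) (φ T) T := by
  have hnot : ∀ y : {y // y ∈ (insert b K)ᶜ}, y.1 ≠ b ∧ y.1 ∉ K := fun y => by
    simpa using y.2
  let f : {y // y ∈ (insert b K)ᶜ} → Choice A k := fun y => coreSet hK y.1 (hnot y).2
  have hf : Function.Injective f := fun y z h => Subtype.ext (coreSet_inj hK h)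
  have hcard : (Finset.univ.image f).card = Fintype.card A - k := by
    rw [Finset.card_image_of_injective _ hf, Finset.card_univ, Fintype.card_coe,
      Finset.card_compl, Finset.card_insert_of_notMem hb, hK]
  rw [← hcard]
  refine log_le_regret hφ (hmem b hb) hε hD ((hE b).optimalByGap hK hb hε.le hpq) ?_ ?_
  · intro h
    obtain ⟨y, -, hy⟩ := Finset.mem_image.mp h
    exact (hnot y).1 (coreSet_inj hK hy)
  · intro s₁ hs₁
    obtain ⟨y, -, rfl⟩ := Finset.mem_image.mp hs₁
    obtain ⟨F, hF, hFD⟩ := hkl y.1 (f y) (hnot y).2 (hnot y).1 rfl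
    refine ⟨E y.1, hmem y.1 (hnot y).2, (hE y.1).optimalByGap hK (hnot y).2 hε.le hpq,
      fun s hs => hlaw y.1 s (hardMean_eq_of_ne s.1 fun h => hs (Subtype.ext h)),
      fun R h0 => by rw [hF R, h0, mul_zero], ?_⟩
    have := sum_mul_log_div_le (fun R => ENNReal.toReal_nonneg) (fun R => ENNReal.toReal_nonneg)
      (PMF.sum_toReal_eq_one ((E b).law (f y))) hF
    linarith

end HardFamily

/-! ### Realizing the means in the two feedback models and bounding the divergences. -/

section Construction

variable {A : Type*} [Fintype A] [DecidableEq A] {k : ℕ}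

/-- The environment with reward laws given by real weights. -/
noncomputable def Environment.ofWeights (w : Choice A k → Finset A → ℝ) (hw : ∀ s R, 0 ≤ w s R)
    (hsum : ∀ s, ∑ R, w s R = 1) (hsub : ∀ s R, ¬ R ⊆ s.1 → w s R = 0) : Environment A k where
  law s := PMF.ofFintype (fun R => ENNReal.ofReal (w s R)) (by
    rw [← ENNReal.ofReal_sum_of_nonneg fun R _ => hw s R, hsum, ENNReal.ofReal_one])
  support_subset s R hR := by
    by_contra h
    rw [PMF.support_ofFintype, Function.mem_support, hsub s R h] at hR
    simp at hR

theorem Environment.ofWeights_law_toReal {w : Choice A k → Finset A → ℝ}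
    (hw : ∀ s R, 0 ≤ w s R) (hsum : ∀ s, ∑ R, w s R = 1)
    (hsub : ∀ s R, ¬ R ⊆ s.1 → w s R = 0) (s : Choice A k) (R : Finset A) :
    ((Environment.ofWeights w hw hsum hsub).law s R).toReal = w s R :=
  ENNReal.toReal_ofReal (hw s R)

/-- The law of independent Bernoulli rewards with means `m` for the arms of `s`. -/
noncomputable def independentWeight (s : Finset A) (m : A → ℝ) (R : Finset A) : ℝ :=
  if R ⊆ s then ∏ a ∈ s, if a ∈ R then m a else 1 - m a else 0

/-- The law of mutually exclusive rewards with means `m` for the arms of `s`. -/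
noncomputable def exclusiveWeight (s : Finset A) (m : A → ℝ) (R : Finset A) : ℝ :=
  (∑ c ∈ s, if R = {c} then m c else 0) + if R = ∅ then 1 - ∑ c ∈ s, m c else 0

theorem sum_powerset_prod_ite (s : Finset A) (f g : A → ℝ) :
    ∑ R ∈ s.powerset, ∏ a ∈ s, (if a ∈ R then f a else g a) = ∏ a ∈ s, (f a + g a) := by
  rw [Finset.prod_add]
  refine Finset.sum_congr rfl fun R hR => ?_
  rw [Finset.prod_ite, Finset.filter_mem_eq_inter, Finset.filter_notMem_eq_sdiff,
    Finset.inter_eq_right.mpr (Finset.mem_powerset.mp hR)]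

theorem sum_independentWeight (s : Finset A) (m : A → ℝ) :
    ∑ R, independentWeight s m R = 1 := by
  have h1 : ∑ R, independentWeight s m R =
      ∑ R ∈ s.powerset, ∏ a ∈ s, (if a ∈ R then m a else 1 - m a) := by
    simp only [independentWeight, ← Finset.sum_filter]
    congr 1
    ext R
    simp
  rw [h1, sum_powerset_prod_ite]
  simp

theorem sum_independentWeight_mem {s : Finset A} (m : A → ℝ) {a : A} (ha : a ∈ s) :
    ∑ R, (if a ∈ R then independentWeight s m R else 0) = m a := by
  -- Replacing the factor `1 - m a` by `0` kills exactly the outcomes without `a`, so the sum still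
  -- factors over arms.
  have h1 : ∑ R, (if a ∈ R then independentWeight s m R else 0) =
      ∑ R ∈ s.powerset, ∏ c ∈ s, (if c ∈ R then m c else if c = a then 0 else 1 - m c) := by
    rw [← Finset.filter_subset_univ, Finset.sum_filter]
    refine Finset.sum_congr rfl fun R _ => ?_
    unfold independentWeight
    by_cases hR : R ⊆ s
    · rw [if_pos hR, if_pos hR]
      split_ifs with haR
      · refine Finset.prod_congr rfl fun c _ => ?_
        by_cases hca : c = a
        · simp [hca, haR]
        · simp [hca]
      · exact (Finset.prod_eq_zero ha (by simp [haR])).symm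
    · simp [hR]
  rw [h1, sum_powerset_prod_ite, ← Finset.mul_prod_erase s _ ha,
    Finset.prod_eq_one fun c hc => ?_]
  · simp
  · simp [Finset.ne_of_mem_erase hc]

/-- The density and the chi-square divergence of two independent reward laws that differ in the
mean of one arm. -/
theorem exists_density_independentWeight {s : Finset A} {m m' : A → ℝ} {x : A} (hx : x ∈ s)
    (hm : ∀ c, c ≠ x → m c = m' c) (h0 : m' x ≠ 0) (h1 : 1 - m' x ≠ 0) :
    ∃ F : Finset A → ℝ, (∀ R, independentWeight s m R = F R * independentWeight s m' R) ∧
      ∑ R, independentWeight s m R * F R =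
        1 + ((m' x - m x) ^ 2 / m' x + (m' x - m x) ^ 2 / (1 - m' x)) := by
  refine ⟨fun R => if x ∈ R then m x / m' x else (1 - m x) / (1 - m' x), fun R => ?_, ?_⟩
  · unfold independentWeight
    by_cases hR : R ⊆ s
    swap
    · simp [hR]
    simp only [if_pos hR]
    by_cases hxR : x ∈ R
    · rw [← Finset.mul_prod_erase s _ hx, ← Finset.mul_prod_erase s _ hx, if_pos hxR, if_pos hxR,
        if_pos hxR, ← mul_assoc, div_mul_cancel₀ _ h0]
      congr 1
      exact Finset.prod_congr rfl fun c hc => by rw [hm c (Finset.ne_of_mem_erase hc)]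
    · rw [← Finset.mul_prod_erase s _ hx, ← Finset.mul_prod_erase s _ hx, if_neg hxR, if_neg hxR,
        if_neg hxR, ← mul_assoc, div_mul_cancel₀ _ h1]
      congr 1
      exact Finset.prod_congr rfl fun c hc => by rw [hm c (Finset.ne_of_mem_erase hc)]
  · have h2 : ∀ R, independentWeight s m R *
        (if x ∈ R then m x / m' x else (1 - m x) / (1 - m' x)) =
        (m x / m' x - (1 - m x) / (1 - m' x)) *
          (if x ∈ R then independentWeight s m R else 0) +
        (1 - m x) / (1 - m' x) * independentWeight s m R := fun R => by
      split_ifs <;> ring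
    simp only [h2]
    rw [Finset.sum_add_distrib, ← Finset.mul_sum, ← Finset.mul_sum,
      sum_independentWeight_mem m hx, sum_independentWeight]
    field_simp
    ring

theorem sum_exclusiveWeight_mul (s : Finset A) (m : A → ℝ) (F : Finset A → ℝ) :
    ∑ R, exclusiveWeight s m R * F R =
      ∑ c ∈ s, m c * F {c} + (1 - ∑ c ∈ s, m c) * F ∅ := by
  simp only [exclusiveWeight, add_mul, Finset.sum_add_distrib, Finset.sum_mul, ite_mul, zero_mul]
  rw [Finset.sum_comm]
  simp

/-- Changing the mean of `x` moves mass only between the outcomes `{x}` and `∅`, so the density is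
`1` on all others and the chi-square divergence has two terms. -/
theorem exists_density_exclusiveWeight {s : Finset A} {m m' : A → ℝ} {x : A} (hx : x ∈ s)
    (hm : ∀ c, c ≠ x → m c = m' c) (h0 : m' x ≠ 0) (h1 : 1 - ∑ c ∈ s, m' c ≠ 0) :
    ∃ F : Finset A → ℝ, (∀ R, exclusiveWeight s m R = F R * exclusiveWeight s m' R) ∧
      ∑ R, exclusiveWeight s m R * F R =
        1 + ((m' x - m x) ^ 2 / m' x + (m' x - m x) ^ 2 / (1 - ∑ c ∈ s, m' c)) := by
  refine ⟨fun R => if R = {x} then m x / m' x else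
    if R = ∅ then (1 - ∑ c ∈ s, m c) / (1 - ∑ c ∈ s, m' c) else 1, fun R => ?_, ?_⟩
  · unfold exclusiveWeight
    by_cases hRx : R = {x}
    · subst hRx
      simp [hx, h0]
    by_cases hR : R = ∅
    · subst hR
      have h2 : ∀ c : A, ¬ (∅ : Finset A) = {c} := fun c => (Finset.singleton_ne_empty c).symm
      simp [h2, h1]
    · simp only [hRx, hR, if_false, add_zero, one_mul]
      refine Finset.sum_congr rfl fun c _ => ?_
      split_ifs with hc
      · exact hm c fun h => hRx (h ▸ hc)
      · rfl
  · rw [sum_exclusiveWeight_mul]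
    have h2 := Finset.add_sum_erase s m hx
    have h3 := Finset.add_sum_erase s m' hx
    have h4 : ∑ c ∈ s.erase x, m c = ∑ c ∈ s.erase x, m' c :=
      Finset.sum_congr rfl fun c hc => hm c (Finset.ne_of_mem_erase hc)
    have h5 : ∑ c ∈ s, m c * (if ({c} : Finset A) = {x} then m x / m' x else
        if ({c} : Finset A) = ∅ then (1 - ∑ c ∈ s, m c) / (1 - ∑ c ∈ s, m' c) else 1) =
        m x * (m x / m' x) + ∑ c ∈ s.erase x, m' c := by
      rw [← Finset.add_sum_erase s _ hx, if_pos rfl, ← h4]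
      congr 1
      refine Finset.sum_congr rfl fun c hc => ?_
      simp [Finset.ne_of_mem_erase hc]
    rw [h5, if_neg (Finset.singleton_ne_empty x).symm, if_pos rfl, ← h2, h4]
    rw [← h3] at h1 ⊢
    generalize ∑ c ∈ s.erase x, m' c = z at *
    field_simp
    ring

/-- The environment with independent rewards of given means. -/
noncomputable def independentEnv (m : Finset A → A → ℝ) (h0 : ∀ s a, 0 ≤ m s a)
    (h1 : ∀ s a, m s a ≤ 1) : Environment A k :=
  Environment.ofWeights (fun s R => independentWeight s.1 (m s.1) R)
    (fun s R => by
      unfold independentWeight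
      split_ifs
      · refine Finset.prod_nonneg fun a _ => ?_
        split_ifs
        · exact h0 _ _
        · exact sub_nonneg.mpr (h1 _ _)
      · exact le_rfl)
    (fun s => sum_independentWeight _ _) (fun _ _ h => if_neg h)

/-- The environment with mutually exclusive rewards of given means. -/
noncomputable def exclusiveEnv (m : Finset A → A → ℝ) (h0 : ∀ s a, 0 ≤ m s a)
    (h1 : ∀ s : Choice A k, ∑ a ∈ s.1, m s.1 a ≤ 1) : Environment A k :=
  Environment.ofWeights (fun s R => exclusiveWeight s.1 (m s.1) R)
    (fun s R => by
      unfold exclusiveWeight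
      refine add_nonneg (Finset.sum_nonneg fun a _ => ?_) ?_
      · split_ifs
        exacts [h0 _ _, le_rfl]
      · split_ifs
        exacts [sub_nonneg.mpr (h1 s), le_rfl])
    (fun s => by simpa using sum_exclusiveWeight_mul s.1 (m s.1) fun _ => 1)
    (fun s R h => by
      unfold exclusiveWeight
      rw [if_neg (by rintro rfl; exact h (Finset.empty_subset _)), add_zero]
      refine Finset.sum_eq_zero fun c hc => if_neg ?_
      rintro rfl
      exact h (Finset.singleton_subset_iff.mpr hc))

theorem independentEnv_law_toReal {m : Finset A → A → ℝ} (h0 : ∀ s a, 0 ≤ m s a)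
    (h1 : ∀ s a, m s a ≤ 1) (s : Choice A k) (R : Finset A) :
    ((independentEnv m h0 h1 : Environment A k).law s R).toReal = independentWeight s.1 (m s.1) R :=
  Environment.ofWeights_law_toReal ..

theorem independentEnv_meanReward {m : Finset A → A → ℝ} (h0 : ∀ s a, 0 ≤ m s a)
    (h1 : ∀ s a, m s a ≤ 1) (s : Choice A k) {a : A} (ha : a ∈ s.1) :
    (independentEnv m h0 h1 : Environment A k).meanReward s a = m s.1 a := by
  unfold Environment.meanReward
  simp only [independentEnv_law_toReal]
  exact sum_independentWeight_mem _ ha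

theorem exclusiveEnv_law_toReal {m : Finset A → A → ℝ} (h0 : ∀ s a, 0 ≤ m s a)
    (h1 : ∀ s : Choice A k, ∑ a ∈ s.1, m s.1 a ≤ 1) (s : Choice A k) (R : Finset A) :
    ((exclusiveEnv m h0 h1 : Environment A k).law s R).toReal = exclusiveWeight s.1 (m s.1) R :=
  Environment.ofWeights_law_toReal ..

theorem exclusiveEnv_meanReward {m : Finset A → A → ℝ} (h0 : ∀ s a, 0 ≤ m s a)
    (h1 : ∀ s : Choice A k, ∑ a ∈ s.1, m s.1 a ≤ 1) (s : Choice A k) {a : A} (ha : a ∈ s.1) :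
    (exclusiveEnv m h0 h1).meanReward s a = m s.1 a := by
  unfold Environment.meanReward
  simp only [exclusiveEnv_law_toReal]
  have := sum_exclusiveWeight_mul s.1 (m s.1) fun R => if a ∈ R then 1 else 0
  simp only [mul_ite, mul_one, mul_zero, Finset.mem_singleton, Finset.notMem_empty, if_false,
    add_zero] at this
  rw [this]
  simp [ha]

theorem independentEnv_independentRewards {m : Finset A → A → ℝ} (h0 : ∀ s a, 0 ≤ m s a)
    (h1 : ∀ s a, m s a ≤ 1) :
    (independentEnv m h0 h1 : Environment A k).IndependentRewards := by
  intro s R hR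
  rw [independentEnv_law_toReal, independentWeight, if_pos hR]
  refine Finset.prod_congr rfl fun a ha => ?_
  rw [independentEnv_meanReward h0 h1 s ha]

theorem exclusiveEnv_mutuallyExclusive {m : Finset A → A → ℝ} (h0 : ∀ s a, 0 ≤ m s a)
    (h1 : ∀ s : Choice A k, ∑ a ∈ s.1, m s.1 a ≤ 1) :
    (exclusiveEnv m h0 h1).MutuallyExclusive := by
  intro s R hR
  by_contra hcard
  have h2 := exclusiveEnv_law_toReal h0 h1 s R
  have h3 : exclusiveWeight s.1 (m s.1) R = 0 := by
    unfold exclusiveWeight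
    rw [if_neg (by rintro rfl; simp at hcard), add_zero]
    refine Finset.sum_eq_zero fun c _ => if_neg ?_
    rintro rfl
    simp at hcard
  rw [h3, ENNReal.toReal_eq_zero_iff] at h2
  exact h2.elim ((PMF.mem_support_iff _ _).mp hR) (PMF.apply_ne_top _ _)

variable {K : Finset A} {b x : A} {p q ε : ℝ}

theorem hardMean_sub_hardMean (hx : x ∉ K) (hxb : x ≠ b) :
    hardMean K b p q ε x (insert x K) x - hardMean K b p q ε b (insert x K) x = 2 * ε := by
  simp [hardMean, hx, hxb]
  ring

theorem hardMean_eq_of_ne_arm (s : Finset A) {c : A} (hc : c ≠ x) :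
    hardMean K b p q ε b s c = hardMean K b p q ε x s c := by
  unfold hardMean
  by_cases hcb : c = b <;> simp [hc, hcb]

theorem sum_hardMean_le_add (hK : K.card + 1 = k) (hε : 0 ≤ ε) (hpq : p + 3 * ε ≤ q)
    (s : Choice A k) :
    ∑ a ∈ s.1, hardMean K b p q ε x s.1 a ≤ K.card * q + (p + ε) := by
  rcases exists_eq_insert_or_two_le hK s with ⟨c, hc, hsc⟩ | h2
  · rw [hsc, sum_hardMean_insert hc]
    split_ifs <;> linarith
  · linarith [sum_hardMean_le (b := b) (x := x) hK hε hpq s h2]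

theorem independent_lower_bound (hK : K.card + 1 = k) (hb : b ∉ K) {a : A}
    (ha : a ∉ insert b K) (hε : 0 < ε) (hε4 : ε ≤ 1 / 4) :
    ∃ E ∈ independentClass A k ε, ∀ φ : BanditAlgorithm A k,
      SubpolynomialRegret (independentClass A k ε) φ → ∀ᶠ T : ℕ in Filter.atTop,
        ε * (((Fintype.card A - k : ℕ) : ℝ) * (Real.log T / (4 * (24 * ε ^ 2)))) ≤
          regret E (φ T) T := by
  -- Here `p = 1/4` and `q = 1`: core arms always receive reward, and `ε ≤ 1/4` gives both `ε ≤ p`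
  -- and `p + 3ε ≤ q`.
  have hpq : 1 / 4 + 3 * ε ≤ 1 := by linarith
  have h0 : ∀ (x : A) (s : Finset A) c, 0 ≤ hardMean K b (1 / 4) 1 ε x s c := fun x s c =>
    hardMean_nonneg hε.le hε4 hpq s c
  have h1 : ∀ (x : A) (s : Finset A) c, hardMean K b (1 / 4) 1 ε x s c ≤ 1 := fun x s c =>
    hardMean_le hε.le hpq s c
  let E : A → Environment A k := fun x => independentEnv _ (h0 x) (h1 x)
  have hE : ∀ x, (E x).HasHardMeans K b (1 / 4) 1 ε x := fun x s c hc =>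
    independentEnv_meanReward _ _ s hc
  have hmem : ∀ x, x ∉ K → E x ∈ independentClass A k ε := fun x hx =>
    ⟨independentEnv_independentRewards _ _, (hE x).weakOptimalSetConsistent hK hx hε hpq,
      (hE x).hasMinGap hK hx hb ha hε.le hpq⟩
  have hlaw : ∀ x s R, ((E x).law s R).toReal =
      independentWeight s.1 (hardMean K b (1 / 4) 1 ε x s.1) R := fun x s R =>
    independentEnv_law_toReal ..
  refine ⟨E b, hmem b hb, fun φ hφ =>
    log_le_regret_of_hasHardMeans hK hb hε hpq (by positivity) hE hmem ?_ ?_ hφ⟩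
  · intro x s h
    refine PMF.ext fun R => (ENNReal.toReal_eq_toReal_iff' (PMF.apply_ne_top _ _)
      (PMF.apply_ne_top _ _)).mp ?_
    rw [hlaw, hlaw, h]
  · intro x s hx hxb hs
    simp only [hlaw, hs]
    have hmx : hardMean K b (1 / 4) 1 ε x (insert x K) x = 1 / 4 + ε := by
      simp [hardMean, hx, hxb]
    obtain ⟨F, hF, hsum⟩ := exists_density_independentWeight (Finset.mem_insert_self x K)
      (m := hardMean K b (1 / 4) 1 ε b (insert x K))
      (m' := hardMean K b (1 / 4) 1 ε x (insert x K)) (fun c hc => hardMean_eq_of_ne_arm _ hc)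
      (by rw [hmx]; linarith) (by rw [hmx]; linarith)
    refine ⟨F, hF, ?_⟩
    rw [hsum, hardMean_sub_hardMean hx hxb, hmx]
    -- The two terms are at most `16ε²` and `8ε²`, whence `24ε²`.
    have e1 : (2 * ε) ^ 2 / (1 / 4 + ε) ≤ (2 * ε) ^ 2 / (1 / 4) := by gcongr; linarith
    have e2 : (2 * ε) ^ 2 / (1 - (1 / 4 + ε)) ≤ (2 * ε) ^ 2 / (1 / 2) := by
      gcongr; linarith
    linarith

theorem exclusive_lower_bound (hK : K.card + 1 = k) (hb : b ∉ K) {a : A}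
    (ha : a ∉ insert b K) (hε : 0 < ε) (hεk : ε ≤ 1 / (4 * (k : ℝ))) :
    ∃ E ∈ exclusiveClass A k ε, ∀ φ : BanditAlgorithm A k,
      SubpolynomialRegret (exclusiveClass A k ε) φ → ∀ᶠ T : ℕ in Filter.atTop,
        ε * (((Fintype.card A - k : ℕ) : ℝ) * (Real.log T / (4 * (24 * k * ε ^ 2)))) ≤
          regret E (φ T) T := by
  have hk : (0 : ℝ) < k := by exact_mod_cast (by omega : 0 < k)
  have hKk : (K.card : ℝ) = k - 1 := by rw [← hK]; push_cast; ring
  -- Here `p = r` and `q = 4r = 1/k`. The core uses total mass `1 - 4r`; the last arm takes at most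
  -- `r + ε ≤ 2r`, so the outcome without reward keeps mass at least `2r` and its term in the
  -- divergence stays of order `ε²/r`.
  set r : ℝ := 1 / (4 * (k : ℝ)) with hr
  have hr0 : 0 < r := by positivity
  have hkr : 4 * (k * r) = 1 := by rw [hr]; field_simp
  have hpq : r + 3 * ε ≤ 4 * r := by linarith
  have hKr : K.card * (4 * r) = 1 - 4 * r := by rw [hKk]; linarith
  have h0 : ∀ (x : A) (s : Finset A) c, 0 ≤ hardMean K b r (4 * r) ε x s c := fun x s c =>
    hardMean_nonneg hε.le hεk hpq s c
  have h1 : ∀ (x : A) (s : Choice A k), ∑ a ∈ s.1, hardMean K b r (4 * r) ε x s.1 a ≤ 1 :=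
    fun x s => (sum_hardMean_le_add hK hε.le hpq s).trans (by linarith)
  let E : A → Environment A k := fun x => exclusiveEnv _ (h0 x) (h1 x)
  have hE : ∀ x, (E x).HasHardMeans K b r (4 * r) ε x := fun x s c hc =>
    exclusiveEnv_meanReward _ _ s hc
  have hmem : ∀ x, x ∉ K → E x ∈ exclusiveClass A k ε := fun x hx =>
    ⟨exclusiveEnv_mutuallyExclusive _ _, (hE x).weakOptimalSetConsistent hK hx hε hpq,
      (hE x).hasMinGap hK hx hb ha hε.le hpq⟩
  have hlaw : ∀ x s R, ((E x).law s R).toReal =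
      exclusiveWeight s.1 (hardMean K b r (4 * r) ε x s.1) R := fun x s R =>
    exclusiveEnv_law_toReal ..
  refine ⟨E b, hmem b hb, fun φ hφ =>
    log_le_regret_of_hasHardMeans hK hb hε hpq (by positivity) hE hmem ?_ ?_ hφ⟩
  · intro x s h
    refine PMF.ext fun R => (ENNReal.toReal_eq_toReal_iff' (PMF.apply_ne_top _ _)
      (PMF.apply_ne_top _ _)).mp ?_
    rw [hlaw, hlaw, h]
  · intro x s hx hxb hs
    simp only [hlaw, hs]
    have hmx : hardMean K b r (4 * r) ε x (insert x K) x = r + ε := by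
      simp [hardMean, hx, hxb]
    have hsumx : 1 - ∑ c ∈ insert x K, hardMean K b r (4 * r) ε x (insert x K) c = 3 * r - ε := by
      rw [sum_hardMean_insert hx, hKr]
      simp [hxb]
      ring
    obtain ⟨F, hF, hsum⟩ := exists_density_exclusiveWeight (Finset.mem_insert_self x K)
      (m := hardMean K b r (4 * r) ε b (insert x K))
      (m' := hardMean K b r (4 * r) ε x (insert x K)) (fun c hc => hardMean_eq_of_ne_arm _ hc)
      (by rw [hmx]; linarith) (by rw [hsumx]; linarith)
    refine ⟨F, hF, ?_⟩
    rw [hsum, hardMean_sub_hardMean hx hxb, hmx, hsumx]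
    have e1 : (2 * ε) ^ 2 / (r + ε) ≤ (2 * ε) ^ 2 / r := by gcongr; linarith
    have e2 : (2 * ε) ^ 2 / (3 * r - ε) ≤ (2 * ε) ^ 2 / (2 * r) := by gcongr; linarith
    have e3 : (2 * ε) ^ 2 / r + (2 * ε) ^ 2 / (2 * r) = 24 * k * ε ^ 2 := by
      rw [hr]; field_simp; ring
    linarith

end Construction

/-! ### Choice of the core and conclusion. -/

theorem exists_core {A : Type*} [Fintype A] [DecidableEq A] {k : ℕ} (hk : 1 ≤ k)
    (hcard : k < Fintype.card A) :
    ∃ (K : Finset A) (b a : A), K.card + 1 = k ∧ b ∉ K ∧ a ∉ insert b K := by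
  obtain ⟨K, -, hK⟩ := Finset.exists_subset_card_eq
    (show k - 1 ≤ (Finset.univ : Finset A).card by rw [Finset.card_univ]; omega)
  obtain ⟨b, -, hb⟩ := Finset.exists_mem_notMem_of_card_lt_card
    (show K.card < (Finset.univ : Finset A).card by rw [Finset.card_univ]; omega)
  obtain ⟨a, -, ha⟩ := Finset.exists_mem_notMem_of_card_lt_card
    (show (insert b K).card < (Finset.univ : Finset A).card by
      rw [Finset.card_univ, Finset.card_insert_of_notMem hb]; omega)
  exact ⟨K, b, a, by omega, hb, ha⟩

theorem mainTheorem3 :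
    ∃ c : ℝ, 0 < c ∧
      ∀ (A : Type*) [Fintype A] [DecidableEq A] (n k : ℕ), 2 ≤ n → 1 ≤ k →
        Fintype.card A = n + k - 1 →
        (∀ ε : ℝ, 0 < ε → ε ≤ 1 / (4 * (k : ℝ)) →
          ∃ E ∈ exclusiveClass A k ε,
            ∀ φ : BanditAlgorithm A k, SubpolynomialRegret (exclusiveClass A k ε) φ →
              ∀ᶠ T : ℕ in Filter.atTop,
                c * ((n : ℝ) * Real.log (T : ℝ) / ((k : ℝ) * ε)) ≤ regret E (φ T) T) ∧
        (∀ ε : ℝ, 0 < ε → ε ≤ 1 / 4 →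
          ∃ E ∈ independentClass A k ε,
            ∀ φ : BanditAlgorithm A k, SubpolynomialRegret (independentClass A k ε) φ →
              ∀ᶠ T : ℕ in Filter.atTop,
                c * ((n : ℝ) * Real.log (T : ℝ) / ε) ≤ regret E (φ T) T) := by
  -- `192 = 2 · 4 · 24`: the `2` from `n - 1 ≥ n / 2`, the `4` from `log T / (4D)`, the `24` from
  -- `D`.
  refine ⟨1 / 192, by norm_num, fun A _ _ n k hn hk hcard => ?_⟩
  obtain ⟨K, b, a, hK, hb, ha⟩ := exists_core (A := A) hk (by omega)
  have hsub : ((Fintype.card A - k : ℕ) : ℝ) = n - 1 := by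
    rw [hcard, show n + k - 1 - k = n - 1 by omega, Nat.cast_sub (by omega), Nat.cast_one]
  have hk0 : (0 : ℝ) < k := by exact_mod_cast (by omega : 0 < k)
  have hn2 : (n : ℝ) / 2 ≤ n - 1 := by
    have : (2 : ℝ) ≤ n := by exact_mod_cast hn
    linarith
  have hlog : ∀ T : ℕ, 0 ≤ Real.log T := fun T => Real.log_natCast_nonneg T
  refine ⟨fun ε hε hεk => ?_, fun ε hε hε4 => ?_⟩
  · obtain ⟨E, hE, hbound⟩ := exclusive_lower_bound hK hb ha hε hεk
    refine ⟨E, hE, fun φ hφ => (hbound φ hφ).mono fun T hT => le_trans ?_ hT⟩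
    have h1 : ε * ((n / 2 : ℝ) * (Real.log T / (4 * (24 * k * ε ^ 2)))) =
        1 / 192 * ((n : ℝ) * Real.log (T : ℝ) / ((k : ℝ) * ε)) := by
      field_simp
      ring
    rw [hsub, ← h1]
    have := hlog T
    gcongr
  · obtain ⟨E, hE, hbound⟩ := independent_lower_bound hK hb ha hε hε4
    refine ⟨E, hE, fun φ hφ => (hbound φ hφ).mono fun T hT => le_trans ?_ hT⟩
    have h1 : ε * ((n / 2 : ℝ) * (Real.log T / (4 * (24 * ε ^ 2)))) =
        1 / 192 * ((n : ℝ) * Real.log (T : ℝ) / ε) := by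
      field_simp
      ring
    rw [hsub, ← h1]
    have := hlog T
    gcongr
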